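/- Let $G$ be a finitely generated torsion-free nilpotent group of nilpotency class $c$. Let $\gamma_1(G)=G,\ \gamma_{i+1}(G)=[\gamma_i(G),G]$ and $Z_0(G)=1,\ Z_1(G)=Z(G),\dots$ denote the lower and upper central series of $G$ (for the trivial group, $c=0$, read $\gamma_c(G)=G$ and $Z_{c-1}(G)=1$). Let $H$ be a subgroup of $G$ of finite index $m$ and $f:H\to G$ an epimorphism. Put $k=[G:HZ_{c-1}(G)]$. Then $Z(H)\le Z(G)$, the index $q=[Z(G):Z(H)]$ is finite, and the index $[\gamma_c(G):\gamma_c(H)]$ is a finite $k$-number (every prime dividing it divides $k$) which divides $q$. If moreover $m$ is square-free and $f$ is simple, meaning that the largest subgroup $K\le H$ which is normal in $G$ and satisfies $f(K)\le K$ is the trivial subgroup, then $G$ is abelian. -/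

import Mathlib

/-- A `𝔗_c`-group: a finitely generated torsion-free nilpotent group of nilpotency class `c`. -/
structure IsTGroup (G : Type*) [Group G] (c : ℕ) : Prop where
  fg : Group.FG G
  torsionFree : ∀ g : G, IsOfFinOrder g → g = 1
  nilpotent : Group.IsNilpotent G
  nilpotencyClass_eq : Group.nilpotencyClass G = c

/-- The term `γ_i(H)` of the lower central series of a subgroup `H` of `G`, as a subgroup of `G`,
numbered so that `γ_1(H) = H` and `γ_{i+1}(H) = [γ_i(H), H]`. By convention `γ_0(H) = H`. -/
def lowerGamma {G : Type*} [Group G] (H : Subgroup G) (i : ℕ) : Subgroup G :=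
  H.lowerCentralSeries (i - 1)

/-- The center `Z(H)` of a subgroup `H` of `G`, viewed as a subgroup of `G`. -/
def centerOf {G : Type*} [Group G] (H : Subgroup G) : Subgroup G :=
  (Subgroup.center H).map H.subtype

/-- `K` is `f`-invariant: `K ≤ H` and `f(K) ≤ K`. -/
def IsInvariantUnder {G : Type*} [Group G] {H : Subgroup G} (f : H →* G) (K : Subgroup G) :
    Prop :=
  K ≤ H ∧ ∀ h : H, (h : G) ∈ K → f h ∈ K

/-- The `f`-core of `H`: the largest `f`-invariant subgroup of `H` that is normal in `G`. -/
def fCore {G : Type*} [Group G] {H : Subgroup G} (f : H →* G) : Subgroup G :=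
  sSup {K : Subgroup G | K.Normal ∧ IsInvariantUnder f K}

theorem fCore_isGreatest {G : Type*} [Group G] {H : Subgroup G} (f : H →* G) :
    IsGreatest {K : Subgroup G | K.Normal ∧ IsInvariantUnder f K} (fCore f) := by
  have hle : fCore f ≤ H := sSup_le fun K hK => hK.2.1
  refine ⟨⟨?_, hle, ?_⟩, fun K hK => le_sSup hK⟩
  · refine ⟨fun x hx g => ?_⟩
    have key : fCore f ≤ (fCore f).comap (MulAut.conj g).toMonoidHom := by
      refine sSup_le fun K hK y hy => ?_
      exact (le_sSup hK : K ≤ fCore f) (hK.1.conj_mem y hy g)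
    exact key hx
  · have key : fCore f ≤ ((fCore f).comap f).map H.subtype := by
      refine sSup_le fun K hK x hx => ?_
      refine ⟨⟨x, hK.2.1 hx⟩, ?_, rfl⟩
      exact (le_sSup hK : K ≤ fCore f) (hK.2.2 ⟨x, hK.2.1 hx⟩ hx)
    intro h hh
    obtain ⟨h', hh', heq⟩ := key hh
    have : h' = h := Subtype.ext heq
    exact this ▸ hh'

/-- The virtual endomorphism `f : H → G` is simple: its `f`-core is trivial. -/
def IsSimpleVirtualEndo {G : Type*} [Group G] {H : Subgroup G} (f : H →* G) : Prop :=
  fCore f = ⊥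

/-- `n` is a `k`-number: a positive integer all of whose prime divisors divide `k`. -/
def IsNumberOver (k n : ℕ) : Prop :=
  n ≠ 0 ∧ ∀ p : ℕ, p.Prime → p ∣ n → p ∣ k

open scoped commutatorElement

/-! ### Groups all of whose subgroups are finitely generated -/

/-! All subgroups of `G` are finitely generated, so the surjection `f` is injective and carries
`γ_c(H)` onto `γ_c(G)` and `Z(H)` onto `Z(G)`. Torsion-freeness gives `Z(H) = H ∩ Z(G)`
(`centerOf_eq_inf_center`). Commutators that are central modulo `Z_e(G)` are bilinear there, whence
`γ_c(G)` to the power `k ^ c` lies in `γ_c(H)` (`pow_mem_lowerCentralSeries_sup`, for `c ≥ 1`); so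
`l` is a finite `k`-number.

For `l ∣ q`, let `T` be the isolator of `γ_c(G)` in `Z(G)`. Then `f` maps `H ∩ T` onto `T`, so `[H ∩
T : γ_c(H)] = [T : γ_c(G)]`; computing `[T : γ_c(H)]` in two ways gives `l = [T : H ∩ T]`, a divisor
of `[Z(G) : H ∩ Z(G)] = q`.

If `c ≥ 2` and `f` is simple, then `l ≠ 1`, and a prime `p ∣ l` divides both `q` and `k`. Since `q =
[H Z(G) : H]`, the product `q * k` divides `m`, so `p²` divides `m`. -/

theorem Subgroup.forall_fg_of_extension {G Q : Type*} [Group G] [Group Q] (φ : G →* Q)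
    (hker : ∀ K ≤ φ.ker, K.FG) (hQ : ∀ K : Subgroup Q, K.FG) (K : Subgroup G) : K.FG := by
  classical
  obtain ⟨S, hS⟩ := hQ (K.map φ)
  have hsub : (S : Set Q) ⊆ φ '' K := by
    intro x hx
    have : x ∈ K.map φ := hS ▸ Subgroup.subset_closure hx
    exact this
  obtain ⟨S', hS'K, rfl⟩ := Finset.subset_set_image_iff.1 hsub
  have hle : Subgroup.closure (S' : Set G) ≤ K := (Subgroup.closure_le K).2 hS'K
  have hK : K = Subgroup.closure (S' : Set G) ⊔ (K ⊓ φ.ker) := by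
    refine le_antisymm (fun x hx => ?_) (sup_le hle inf_le_left)
    have hφx : φ x ∈ (Subgroup.closure (S' : Set G)).map φ := by
      rw [MonoidHom.map_closure, ← Finset.coe_image, hS]
      exact ⟨x, hx, rfl⟩
    obtain ⟨y, hy, hyx⟩ := hφx
    have hz : y⁻¹ * x ∈ K ⊓ φ.ker :=
      ⟨K.mul_mem (K.inv_mem (hle hy)) hx, by simp [hyx]⟩
    simpa using Subgroup.mul_mem_sup hy hz
  rw [hK]
  exact Subgroup.FG.sup ⟨S', rfl⟩ (hker _ inf_le_right)

theorem CommGroup.subgroup_fg {A : Type*} [CommGroup A] [Group.FG A] (K : Subgroup A) : K.FG := by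
  have : Module.Finite ℤ (Additive A) :=
    Module.Finite.iff_addGroup_fg.2 (GroupFG.iff_add_fg.1 inferInstance)
  have hN : IsNoetherian ℤ (Additive A) := inferInstance
  rw [Subgroup.fg_iff_add_fg]
  have := hN.noetherian (AddSubgroup.toIntSubmodule K.toAddSubgroup)
  rw [Submodule.fg_iff_addSubgroup_fg] at this
  simpa using this

theorem Subgroup.isMulCommutative_of_le_center {G : Type*} [Group G] {B : Subgroup G}
    (hB : B ≤ Subgroup.center G) : IsMulCommutative B :=
  ⟨⟨fun a b => Subtype.ext ((Subgroup.mem_center_iff.1 (hB b.2) a))⟩⟩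

theorem Subgroup.fg_of_le_of_le_center {G : Type*} [Group G] {B K : Subgroup G}
    (hB : B ≤ Subgroup.center G) (hfg : B.FG) (hK : K ≤ B) : K.FG := by
  let : CommGroup B := { (inferInstance : Group B) with
    mul_comm := (Subgroup.isMulCommutative_of_le_center hB).is_comm.comm }
  have : Group.FG B := (Group.fg_iff_subgroup_fg B).2 hfg
  obtain ⟨S, hS⟩ := CommGroup.subgroup_fg (K.subgroupOf B)
  exact (Subgroup.fg_iff K).2 ⟨B.subtype '' S, by
    rw [← MonoidHom.map_closure, hS, Subgroup.map_subgroupOf_eq_of_le hK], S.finite_toSet.image _⟩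

/-- The commutators of generators generate a central, hence normal, subgroup; modulo it the elements
of `S` become central. -/
theorem Subgroup.commutator_fg_of_le_center {G : Type*} [Group G] [Group.FG G] {A : Subgroup G}
    (hA : ∃ S : Set G, S.Finite ∧ S ⊆ A ∧ A ≤ Subgroup.closure S ⊔ Subgroup.center G)
    (hc : ⁅A, (⊤ : Subgroup G)⁆ ≤ Subgroup.center G) : (⁅A, (⊤ : Subgroup G)⁆ : Subgroup G).FG := by
  obtain ⟨S, hSfin, hSA, hAS⟩ := hA
  obtain ⟨T, hT, hTfin⟩ := Group.fg_iff.1 (inferInstance : Group.FG G)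
  set X : Set G := Set.image2 (fun s t => ⁅s, t⁆) S T with hX
  have hXle : Subgroup.closure X ≤ ⁅A, (⊤ : Subgroup G)⁆ := by
    rw [Subgroup.closure_le]
    rintro _ ⟨s, hs, t, -, rfl⟩
    exact Subgroup.commutator_mem_commutator (hSA hs) (Subgroup.mem_top t)
  have hN : (Subgroup.closure X).Normal :=
    ⟨fun x hx g => by
      rw [Subgroup.mem_center_iff.1 (hc (hXle hx)) g, mul_inv_cancel_right]; exact hx⟩
  have hle : ⁅A, (⊤ : Subgroup G)⁆ ≤ Subgroup.closure X := by
    have hS : Subgroup.closure S ≤ Subgroup.upperCentralSeriesStep (Subgroup.closure X) := by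
      rw [Subgroup.closure_le]
      intro s hs
      have hcent : Subgroup.closure T ≤ (Subgroup.centralizer
          {QuotientGroup.mk' (Subgroup.closure X) s}).comap
          (QuotientGroup.mk' (Subgroup.closure X)) := by
        rw [Subgroup.closure_le]
        intro t ht
        rw [SetLike.mem_coe, Subgroup.mem_comap, Subgroup.mem_centralizer_singleton_iff,
          eq_comm, ← commutatorElement_eq_one_iff_mul_comm, ← map_commutatorElement,
          ← MonoidHom.mem_ker, QuotientGroup.ker_mk']
        exact Subgroup.subset_closure ⟨s, hs, t, ht, rfl⟩
      intro g
      have hg := hcent (hT ▸ Subgroup.mem_top g)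
      rwa [Subgroup.mem_comap, Subgroup.mem_centralizer_singleton_iff,
          eq_comm, ← commutatorElement_eq_one_iff_mul_comm, ← map_commutatorElement,
          ← MonoidHom.mem_ker, QuotientGroup.ker_mk'] at hg
    have hZ : Subgroup.center G ≤ Subgroup.upperCentralSeriesStep (Subgroup.closure X) := by
      intro z hz g
      rw [commutatorElement_eq_one_iff_mul_comm.2 (Subgroup.mem_center_iff.1 hz g).symm]
      exact one_mem _
    exact Subgroup.commutator_le.2 fun a ha g _ => sup_le hS hZ (hAS ha) g
  rw [le_antisymm hle hXle, Subgroup.fg_iff]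
  exact ⟨X, rfl, hSfin.image2 _ hTfin⟩

/-- Induction on the class: the last term `γ` is central, and finitely generated because the term
before it is finitely generated modulo `γ`. -/
theorem Subgroup.forall_fg_of_lowerCentralSeries_eq_bot (n : ℕ) :
    ∀ (G : Type*) [Group G] [Group.FG G], (⊤ : Subgroup G).lowerCentralSeries n = ⊥ →
      ∀ K : Subgroup G, K.FG := by
  induction n with
  | zero =>
    intro G _ _ h K
    have hK : K = ⊥ := le_bot_iff.1 (le_top.trans h.le)
    exact hK ▸ Subgroup.FG.bot
  | succ n ih =>
    intro G _ _ h
    set γ := (⊤ : Subgroup G).lowerCentralSeries n with hγ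
    have hγc : γ ≤ Subgroup.center G :=
      Subgroup.commutator_top_right_eq_bot_iff_le_center.1 h
    have hQ : ∀ K : Subgroup (G ⧸ γ), K.FG := by
      refine ih (G ⧸ γ) ?_
      rw [← Subgroup.map_top_of_surjective _ (QuotientGroup.mk'_surjective γ),
        ← Subgroup.map_lowerCentralSeries, ← hγ, QuotientGroup.map_mk'_self]
    have hγfg : γ.FG := by
      cases n with
      | zero => exact Group.fg_def.1 inferInstance
      | succ n =>
        refine Subgroup.commutator_fg_of_le_center ?_ hγc
        classical
        set A := (⊤ : Subgroup G).lowerCentralSeries n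
        obtain ⟨S, hS⟩ := hQ (A.map (QuotientGroup.mk' γ))
        have hsub : (S : Set (G ⧸ γ)) ⊆ QuotientGroup.mk' γ '' A := by
          intro x hx
          have : x ∈ A.map (QuotientGroup.mk' γ) := hS ▸ Subgroup.subset_closure hx
          exact this
        obtain ⟨S', hS'A, rfl⟩ := Finset.subset_set_image_iff.1 hsub
        refine ⟨S', S'.finite_toSet, hS'A, fun a ha => ?_⟩
        have h1 : QuotientGroup.mk' γ a ∈ (Subgroup.closure (S' : Set G)).map
            (QuotientGroup.mk' γ) := by
          rw [MonoidHom.map_closure, ← Finset.coe_image, hS]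
          exact ⟨a, ha, rfl⟩
        rw [← Subgroup.mem_comap, Subgroup.comap_map_eq, QuotientGroup.ker_mk'] at h1
        exact sup_le_sup_left hγc _ h1
    refine Subgroup.forall_fg_of_extension (QuotientGroup.mk' γ) (fun K hK => ?_) hQ
    rw [QuotientGroup.ker_mk'] at hK
    exact Subgroup.fg_of_le_of_le_center hγc hγfg hK

/-! ### Surjective virtual endomorphisms are injective -/

/-- The kernels of the iterates of a virtual endomorphism. -/
def iterKer {G : Type*} [Group G] {H : Subgroup G} (f : H →* G) : ℕ → Subgroup G
  | 0 => ⊥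
  | n + 1 => ((iterKer f n).comap f).map H.subtype

theorem iterKer_le_succ {G : Type*} [Group G] {H : Subgroup G} (f : H →* G) (n : ℕ) :
    iterKer f n ≤ iterKer f (n + 1) := by
  induction n with
  | zero => exact bot_le
  | succ n ih => exact Subgroup.map_mono (Subgroup.comap_mono ih)

theorem exists_iterKer_stable {G : Type*} [Group G] (hG : ∀ K : Subgroup G, K.FG) {H : Subgroup G}
    (f : H →* G) : ∃ n, iterKer f (n + 1) = iterKer f n := by
  have hmono : Monotone (iterKer f) := monotone_nat_of_le_succ (iterKer_le_succ f)
  obtain ⟨S, hS⟩ := hG (⨆ n, iterKer f n)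
  have hex : ∀ s ∈ S, ∃ n, s ∈ iterKer f n := fun s hs => by
    have : s ∈ ⨆ n, iterKer f n := hS ▸ Subgroup.subset_closure hs
    exact (Subgroup.mem_iSup_of_directed hmono.directed_le).1 this
  choose! N hN using hex
  refine ⟨S.sup N, le_antisymm ((le_iSup (iterKer f) _).trans ?_) (iterKer_le_succ f _)⟩
  rw [← hS, Subgroup.closure_le]
  exact fun s hs => hmono (Finset.le_sup hs) (hN s hs)

/-- Hopfian argument: the kernels of the iterates stabilise, and since preimage under a surjection
is injective on subgroups, stability descends to the first step. -/
theorem injective_of_surjective_of_forall_fg {G : Type*} [Group G] (hG : ∀ K : Subgroup G, K.FG)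
    {H : Subgroup G} (f : H →* G) (hf : Function.Surjective f) : Function.Injective f := by
  have key : ∀ n, iterKer f (n + 1) = iterKer f n → iterKer f 1 = ⊥ := by
    intro n
    induction n with
    | zero => exact id
    | succ n ih =>
      intro h
      exact ih (Subgroup.comap_injective hf (Subgroup.map_injective H.subtype_injective h))
  obtain ⟨n, hn⟩ := exists_iterKer_stable hG f
  rw [← MonoidHom.ker_eq_bot_iff]
  exact (Subgroup.map_eq_bot_iff_of_injective _ H.subtype_injective).1 (key n hn)

/-! ### Roots in torsion-free nilpotent groups -/

/-- By induction `⁅x, g⁆`, one step lower in the central series, commutes with `g`; then `⁅x, g⁆ ^ n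
= 1`, and there is no torsion. -/
theorem commute_of_commute_pow {G : Type*} [Group G] (htf : ∀ g : G, IsOfFinOrder g → g = 1)
    {n : ℕ} (hn : n ≠ 0) {g : G} (i : ℕ) :
    ∀ x ∈ Subgroup.upperCentralSeries G i, Commute x (g ^ n) → Commute x g := by
  induction i with
  | zero =>
    intro x hx _
    rw [Subgroup.upperCentralSeries_zero, Subgroup.mem_bot] at hx
    exact hx ▸ Commute.one_left g
  | succ i ih =>
    intro x hx hxg
    have hg : Commute g (g ^ n) := Commute.self_pow g n
    have hy : Commute ⁅x, g⁆ (g ^ n) :=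
      ((hxg.mul_left hg).mul_left hxg.inv_left).mul_left hg.inv_left
    have hyg := ih ⁅x, g⁆ (hx g) hy
    have h1 : x * g * x⁻¹ = ⁅x, g⁆ * g := by simp [commutatorElement_def]
    have h2 : ⁅x, g⁆ ^ n * g ^ n = g ^ n := by
      rw [← hyg.mul_pow, ← h1, conj_pow, hxg.eq, mul_inv_cancel_right]
    have h3 : ⁅x, g⁆ = 1 :=
      htf _ (isOfFinOrder_iff_pow_eq_one.2 ⟨n, Nat.pos_of_ne_zero hn, by simpa using h2⟩)
    exact commutatorElement_eq_one_iff_commute.1 h3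

theorem mem_centerOf {G : Type*} [Group G] {H : Subgroup G} {x : G} :
    x ∈ centerOf H ↔ x ∈ H ∧ ∀ h ∈ H, h * x = x * h := by
  constructor
  · rintro ⟨y, hy, rfl⟩
    exact ⟨y.2, fun h hh => congrArg Subtype.val (Subgroup.mem_center_iff.1 hy ⟨h, hh⟩)⟩
  · rintro ⟨hx, h⟩
    exact ⟨⟨x, hx⟩, Subgroup.mem_center_iff.2 fun y => Subtype.ext (h y y.2), rfl⟩

theorem centerOf_eq_inf_center {G : Type*} [Group G] [Group.IsNilpotent G]
    (htf : ∀ g : G, IsOfFinOrder g → g = 1) {H : Subgroup G} (hH : H.index ≠ 0) :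
    centerOf H = H ⊓ Subgroup.center G := by
  ext x
  rw [mem_centerOf, Subgroup.mem_inf]
  refine and_congr_right fun _ => ⟨fun h => ?_, fun h g _ => Subgroup.mem_center_iff.1 h g⟩
  rw [Subgroup.mem_center_iff]
  intro g
  obtain ⟨n, hn, -, hgn⟩ := Subgroup.exists_pow_mem_of_index_ne_zero hH g
  obtain ⟨i, hi⟩ := Group.IsNilpotent.nilpotent G
  exact (commute_of_commute_pow htf hn.ne' i x (hi ▸ Subgroup.mem_top x) (h _ hgn).symm).symm

/-! ### Commutator calculus -/

theorem commutatorElement_pow_pow_of_mem_center {Q : Type*} [Group Q] {a b : Q}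
    (h : ⁅a, b⁆ ∈ Subgroup.center Q) (m n : ℕ) : ⁅a ^ m, b ^ n⁆ = ⁅a, b⁆ ^ (m * n) := by
  have right : ∀ {a b : Q}, ⁅a, b⁆ ∈ Subgroup.center Q → ∀ n : ℕ, ⁅a, b ^ n⁆ = ⁅a, b⁆ ^ n := by
    intro a b h n
    have h1 : a * b * a⁻¹ = ⁅a, b⁆ * b := by simp [commutatorElement_def]
    have hc : Commute ⁅a, b⁆ b := (Subgroup.mem_center_iff.1 h b).symm
    rw [commutatorElement_def, ← conj_pow, h1, hc.mul_pow, mul_inv_cancel_right]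
  have hb : ⁅b, a⁆ ∈ Subgroup.center Q := by
    rw [← commutatorElement_inv]; exact inv_mem h
  have hba : ⁅b ^ n, a⁆ ∈ Subgroup.center Q := by
    rw [← commutatorElement_inv, right h]; exact inv_mem (pow_mem h n)
  rw [← commutatorElement_inv, right hba, ← commutatorElement_inv a, inv_pow, inv_inv, right h,
    ← pow_mul, mul_comm]

theorem commutatorElement_mul_mul_of_commute {Q : Type*} [Group Q] {a z b w : Q}
    (hz : z ∈ Subgroup.center Q) (hw : Commute a w) : ⁅a * z, b * w⁆ = ⁅a, b⁆ := by
  have hz' := Subgroup.mem_center_iff.1 hz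
  have h1 : a * z * (b * w) * (a * z)⁻¹ = a * (b * w) * a⁻¹ := by
    rw [mul_inv_rev, mul_assoc a z, ← hz' (b * w)]
    group
  rw [commutatorElement_def, h1, commutatorElement_def, mul_inv_rev, mul_assoc a (b * w),
    mul_assoc b w, (hw.symm.inv_right).eq]
  group

theorem Subgroup.commutator_commutator_le_of_rotate {G : Type*} [Group G]
    {H₁ H₂ H₃ N : Subgroup G} [N.Normal] (h1 : ⁅⁅H₂, H₃⁆, H₁⁆ ≤ N) (h2 : ⁅⁅H₃, H₁⁆, H₂⁆ ≤ N) :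
    ⁅⁅H₁, H₂⁆, H₃⁆ ≤ N := by
  rw [← QuotientGroup.ker_mk' N, ← Subgroup.map_eq_bot_iff] at h1 h2 ⊢
  simp only [Subgroup.map_commutator] at h1 h2 ⊢
  exact Subgroup.commutator_commutator_eq_bot_of_rotate h1 h2

/-- Induction through the three subgroups lemma. -/
theorem commutator_lowerCentralSeries_upperCentralSeries_le {G : Type*} [Group G] (i : ℕ) :
    ∀ e, ⁅(⊤ : Subgroup G).lowerCentralSeries i, Subgroup.upperCentralSeries G (e + i + 1)⁆ ≤
      Subgroup.upperCentralSeries G e := by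
  induction i with
  | zero =>
    intro e
    rw [Subgroup.commutator_comm]
    exact Subgroup.commutator_upperCentralSeries_top_le G e
  | succ i ih =>
    intro e
    rw [Subgroup.lowerCentralSeries_succ]
    refine Subgroup.commutator_commutator_le_of_rotate ?_ ?_
    · have h : ⁅(⊤ : Subgroup G), Subgroup.upperCentralSeries G (e + (i + 1) + 1)⁆ ≤
          Subgroup.upperCentralSeries G (e + i + 1) := by
        rw [Subgroup.commutator_comm]
        exact Subgroup.commutator_upperCentralSeries_top_le G (e + i + 1)
      refine (Subgroup.commutator_mono h le_rfl).trans ?_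
      rw [Subgroup.commutator_comm]
      exact ih e
    · have h := ih (e + 1)
      rw [show e + 1 + i + 1 = e + (i + 1) + 1 by ring, Subgroup.commutator_comm] at h
      exact (Subgroup.commutator_mono h le_rfl).trans
        (Subgroup.commutator_upperCentralSeries_top_le G e)

theorem lowerCentralSeries_le_upperCentralSeries {G : Type*} [Group G] {d : ℕ}
    (hd : Subgroup.upperCentralSeries G (d + 1) = ⊤) (i e : ℕ) (h : i + e = d) :
    (⊤ : Subgroup G).lowerCentralSeries i ≤ Subgroup.upperCentralSeries G (e + 1) := by
  induction i generalizing e with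
  | zero =>
    obtain rfl : e = d := by omega
    rw [hd]; exact le_top
  | succ i ih =>
    refine (Subgroup.commutator_mono (ih (e + 1) (by omega)) le_rfl).trans ?_
    exact Subgroup.commutator_upperCentralSeries_top_le G (e + 1)

/-- Modulo `Z_e`, `⁅x, g⁆ ^ k ^ (i + 2) = ⁅x ^ k ^ (i + 1), g ^ k⁆`. Writing the two entries as `a *
z` and `b * w` with `a`, `b` in the series of `H`, the factors `z` and `w` drop out. -/
theorem pow_mem_lowerCentralSeries_sup {G : Type*} [Group G] {d : ℕ}
    (hd : Subgroup.upperCentralSeries G (d + 1) = ⊤) (H : Subgroup G) {k : ℕ}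
    (hk : k = (H ⊔ Subgroup.upperCentralSeries G d).index) (i e : ℕ) (h : i + e = d) :
    ∀ x ∈ (⊤ : Subgroup G).lowerCentralSeries i,
      x ^ k ^ (i + 1) ∈ H.lowerCentralSeries i ⊔ Subgroup.upperCentralSeries G e := by
  have hbase : ∀ x : G, x ^ k ∈ H ⊔ Subgroup.upperCentralSeries G d := by
    intro x
    have : (H ⊔ Subgroup.upperCentralSeries G d).Normal := by
      refine Subgroup.Normal.of_commutator_le G (le_trans ?_ le_sup_right)
      rw [commutator_def]
      nth_rw 1 [← hd]
      exact Subgroup.commutator_upperCentralSeries_top_le G d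
    rw [hk]
    exact Subgroup.pow_index_mem _ x
  induction i generalizing e with
  | zero =>
    obtain rfl : e = d := by omega
    intro x _
    simpa using hbase x
  | succ i ih =>
    set N := Subgroup.upperCentralSeries G e
    set π := QuotientGroup.mk' N
    have hcen : ∀ x ∈ Subgroup.upperCentralSeries G (e + 1), π x ∈ Subgroup.center (G ⧸ N) := by
      intro x hx
      rw [← Subgroup.mem_comap, ← Subgroup.upperCentralSeriesStep_eq_comap_center]
      exact hx
    have hpow : ⁅(⊤ : Subgroup G).lowerCentralSeries i, (⊤ : Subgroup G)⁆ ≤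
        Subgroup.upperCentralSeries G (e + 1) :=
      lowerCentralSeries_le_upperCentralSeries hd (i + 1) e h
    -- Centrality makes the power map multiplicative, so `R` is a subgroup and only commutators need
    -- checking.
    let R : Subgroup (G ⧸ N) :=
      { carrier := {y | y ∈ Subgroup.center (G ⧸ N) ∧
          y ^ k ^ (i + 1 + 1) ∈ (H.lowerCentralSeries (i + 1)).map π}
        one_mem' := ⟨one_mem _, by rw [one_pow]; exact one_mem _⟩
        mul_mem' := fun {a b} ha hb => ⟨mul_mem ha.1 hb.1, by
          rw [Commute.mul_pow (Subgroup.mem_center_iff.1 hb.1 a)]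
          exact mul_mem ha.2 hb.2⟩
        inv_mem' := fun {a} ha => ⟨inv_mem ha.1, by rw [inv_pow]; exact inv_mem ha.2⟩ }
    have hle : (⊤ : Subgroup G).lowerCentralSeries (i + 1) ≤ R.comap π := by
      rw [Subgroup.lowerCentralSeries_succ, Subgroup.commutator_le]
      intro x hx g _
      have hxg : π ⁅x, g⁆ ∈ Subgroup.center (G ⧸ N) :=
        hcen _ (hpow (Subgroup.commutator_mem_commutator hx (Subgroup.mem_top g)))
      refine ⟨hxg, ?_⟩
      obtain ⟨a, ha, z, hz, haz⟩ := Subgroup.mem_sup_of_normal_right.1 (ih (e + 1) (by omega) x hx)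
      obtain ⟨b, hb, w, hw, hbw⟩ := Subgroup.mem_sup_of_normal_right.1 (hbase g)
      have haw : Commute (π a) (π w) := by
        rw [← commutatorElement_eq_one_iff_commute, ← map_commutatorElement, ← MonoidHom.mem_ker,
          QuotientGroup.ker_mk']
        have hw' : w ∈ Subgroup.upperCentralSeries G (e + i + 1) := by
          rwa [show e + i + 1 = d by omega]
        exact commutator_lowerCentralSeries_upperCentralSeries_le i e
          (Subgroup.commutator_mem_commutator
            (Subgroup.lowerCentralSeries_mono i le_top ha) hw')
      rw [map_commutatorElement] at hxg ⊢
      rw [pow_succ, ← commutatorElement_pow_pow_of_mem_center hxg, ← map_pow, ← map_pow, ← haz,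
        ← hbw, map_mul, map_mul, commutatorElement_mul_mul_of_commute (hcen z hz) haw,
        ← map_commutatorElement]
      exact ⟨_, Subgroup.commutator_mem_commutator ha hb, rfl⟩
    intro x hx
    have := (hle hx).2
    rwa [← map_pow, ← Subgroup.mem_comap, Subgroup.comap_map_eq, QuotientGroup.ker_mk'] at this

/-! ### Indices in central subgroups -/

theorem Subgroup.relIndex_ne_zero_of_forall_pow_mem {G : Type*} [Group G] {A B : Subgroup G}
    (hB : B ≤ Subgroup.center G) (hfg : B.FG) (h : ∀ x ∈ B, ∃ n : ℕ, n ≠ 0 ∧ x ^ n ∈ A) :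
    A.relIndex B ≠ 0 := by
  let : CommGroup B := { (inferInstance : Group B) with
    mul_comm := (Subgroup.isMulCommutative_of_le_center hB).is_comm.comm }
  have : Group.FG B := (Group.fg_iff_subgroup_fg B).2 hfg
  have : Group.FG (B ⧸ A.subgroupOf B) := inferInstance
  have ht : IsMulTorsion (B ⧸ A.subgroupOf B) := by
    intro y
    obtain ⟨x, rfl⟩ := QuotientGroup.mk_surjective y
    obtain ⟨n, hn, hx⟩ := h x x.2
    refine isOfFinOrder_iff_pow_eq_one.2 ⟨n, Nat.pos_of_ne_zero hn, ?_⟩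
    rw [← QuotientGroup.mk_pow, QuotientGroup.eq_one_iff, Subgroup.mem_subgroupOf]
    simpa using hx
  have : Finite (B ⧸ A.subgroupOf B) := CommGroup.finite_of_fg_isMulTorsion _ ht
  exact Subgroup.index_ne_zero_of_finite

theorem Subgroup.prime_dvd_of_dvd_relIndex {G : Type*} [Group G] {A B : Subgroup G}
    (hB : B ≤ Subgroup.center G) (h0 : A.relIndex B ≠ 0) {n : ℕ} (h : ∀ x ∈ B, x ^ n ∈ A)
    {p : ℕ} (hp : p.Prime) (hpd : p ∣ A.relIndex B) : p ∣ n := by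
  let : CommGroup B := { (inferInstance : Group B) with
    mul_comm := (Subgroup.isMulCommutative_of_le_center hB).is_comm.comm }
  have : Finite (B ⧸ A.subgroupOf B) := Nat.finite_of_card_ne_zero h0
  have : Fact p.Prime := ⟨hp⟩
  obtain ⟨y, hy⟩ := exists_prime_orderOf_dvd_card' (G := B ⧸ A.subgroupOf B) p hpd
  rw [← hy]
  refine orderOf_dvd_of_pow_eq_one ?_
  obtain ⟨x, rfl⟩ := QuotientGroup.mk_surjective y
  rw [← QuotientGroup.mk_pow, QuotientGroup.eq_one_iff, Subgroup.mem_subgroupOf]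
  simpa using h x x.2

theorem Subgroup.relIndex_dvd_relIndex_of_le_center {G : Type*} [Group G] (H : Subgroup G)
    {T Z : Subgroup G} (hTZ : T ≤ Z) (hZ : Z ≤ Subgroup.center G) :
    H.relIndex T ∣ H.relIndex Z := by
  have : IsMulCommutative Z := Subgroup.isMulCommutative_of_le_center hZ
  rw [← Subgroup.relIndex_subgroupOf hTZ]
  exact Subgroup.relIndex_dvd_index_of_normal _ _

theorem Subgroup.relIndex_sup_of_le_center {G : Type*} [Group G] (H : Subgroup G)
    {Z : Subgroup G} (hZ : Z ≤ Subgroup.center G) : H.relIndex (H ⊔ Z) = H.relIndex Z := by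
  have hn : H ⊔ Z ≤ Subgroup.normalizer (H : Set G) :=
    sup_le Subgroup.le_normalizer (hZ.trans (Subgroup.center_le_normalizer _))
  have : (H.subgroupOf (H ⊔ Z)).Normal := (Subgroup.normal_subgroupOf_iff_le_normalizer
    le_sup_left).2 hn
  have h := Subgroup.relIndex_sup_right (Z.subgroupOf (H ⊔ Z)) (H.subgroupOf (H ⊔ Z))
  rw [← Subgroup.subgroupOf_sup le_sup_right le_sup_left, sup_comm Z H,
    Subgroup.subgroupOf_self, Subgroup.relIndex_top_right] at h
  rw [Subgroup.relIndex, h, Subgroup.relIndex_subgroupOf le_sup_right]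

/-- The elements of the center with a nontrivial power in `A`. -/
def centralIsolator {G : Type*} [Group G] (A : Subgroup G) : Subgroup G where
  carrier := {x | x ∈ Subgroup.center G ∧ ∃ n : ℕ, n ≠ 0 ∧ x ^ n ∈ A}
  one_mem' := ⟨one_mem _, 1, one_ne_zero, by rw [one_pow]; exact one_mem A⟩
  mul_mem' := by
    rintro a b ⟨ha, m, hm, ham⟩ ⟨hb, n, hn, hbn⟩
    refine ⟨mul_mem ha hb, m * n, mul_ne_zero hm hn, ?_⟩
    rw [Commute.mul_pow (Subgroup.mem_center_iff.1 hb a)]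
    refine mul_mem ?_ ?_
    · rw [pow_mul]; exact pow_mem ham n
    · rw [mul_comm, pow_mul]; exact pow_mem hbn m
  inv_mem' := by
    rintro a ⟨ha, m, hm, ham⟩
    exact ⟨inv_mem ha, m, hm, by rw [inv_pow]; exact inv_mem ham⟩

theorem mem_centralIsolator {G : Type*} [Group G] {A : Subgroup G} {x : G} :
    x ∈ centralIsolator A ↔ x ∈ Subgroup.center G ∧ ∃ n : ℕ, n ≠ 0 ∧ x ^ n ∈ A := Iff.rfl
/-! ### The lower central series under a virtual automorphism -/

theorem comap_lowerCentralSeries_eq {G : Type*} [Group G] {H : Subgroup G} {f : H →* G}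
    (hf : Function.Bijective f) (d : ℕ) :
    ((⊤ : Subgroup G).lowerCentralSeries d).comap f = (H.lowerCentralSeries d).subgroupOf H := by
  rw [← Subgroup.map_top_of_surjective f hf.2, ← Subgroup.map_lowerCentralSeries,
    Subgroup.comap_map_eq_self_of_injective hf.1, ← Subgroup.top_subtype_lowerCentralSeries H,
    Subgroup.subgroupOf, Subgroup.comap_map_eq_self_of_injective H.subtype_injective]

/-- `f` trades powers in `A` for powers in the smaller `B`; `hpow` absorbs the difference, so the
isolator is the same on both sides. -/
theorem comap_centralIsolator_eq {G : Type*} [Group G] {H : Subgroup G} {f : H →* G}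
    (hf : Function.Bijective f) (hcen : centerOf H = H ⊓ Subgroup.center G) {A B : Subgroup G}
    (hAB : A.comap f = B.subgroupOf H) (hBA : B ≤ A)
    (hpow : ∃ n : ℕ, n ≠ 0 ∧ ∀ x ∈ A, x ^ n ∈ B) :
    (centralIsolator A).comap f = (centralIsolator A).subgroupOf H := by
  ext x
  have hxc : f x ∈ Subgroup.center G ↔ (x : G) ∈ Subgroup.center G := by
    have h1 : (x : G) ∈ Subgroup.center G ↔ (x : G) ∈ centerOf H := by simp [hcen]
    rw [h1, mem_centerOf, Subgroup.mem_center_iff]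
    constructor
    · exact fun h => ⟨x.2, fun y hy => congrArg Subtype.val (hf.1 (a₁ := ⟨y, hy⟩ * x)
        (a₂ := x * ⟨y, hy⟩) (by rw [map_mul, map_mul, h]))⟩
    · rintro ⟨-, h⟩ g
      obtain ⟨y, rfl⟩ := hf.2 g
      rw [← map_mul, ← map_mul, show y * x = x * y from Subtype.ext (h y y.2)]
  have hmem : ∀ n : ℕ, f x ^ n ∈ A ↔ (x : G) ^ n ∈ B := by
    intro n
    rw [← map_pow, ← Subgroup.mem_comap, hAB, Subgroup.mem_subgroupOf]
    rfl
  rw [Subgroup.mem_comap, Subgroup.mem_subgroupOf, mem_centralIsolator, mem_centralIsolator, hxc]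
  refine and_congr_right fun _ => ⟨?_, ?_⟩
  · rintro ⟨n, hn, h⟩
    exact ⟨n, hn, hBA ((hmem n).1 h)⟩
  · rintro ⟨n, hn, h⟩
    obtain ⟨e, he, hA⟩ := hpow
    refine ⟨n * e, mul_ne_zero hn he, (hmem _).2 ?_⟩
    rw [pow_mul]
    exact hA _ h

theorem mainTheorem5 {G : Type*} [Group G] (c : ℕ) (hG : IsTGroup G c)
    (H : Subgroup G) (m : ℕ) (hm : m ≠ 0) (hHm : H.index = m)
    (f : H →* G) (hf : Function.Surjective f)
    (k q l : ℕ)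
    (hk : k = (H ⊔ Subgroup.upperCentralSeries G (c - 1)).index)
    (hq : q = (centerOf H).relIndex (Subgroup.center G))
    (hl : l = (lowerGamma H c).relIndex (lowerGamma ⊤ c)) :
    (centerOf H ≤ Subgroup.center G ∧ q ≠ 0) ∧
    (lowerGamma H c ≤ lowerGamma ⊤ c ∧ IsNumberOver k l ∧ l ∣ q) ∧
    (IsSimpleVirtualEndo f → Squarefree m → ∀ x y : G, x * y = y * x) := by
  have := hG.fg
  have := hG.nilpotent
  have hclass := hG.nilpotencyClass_eq
  unfold lowerGamma at hl ⊢
  set d := c - 1 with hd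
  have hup : Subgroup.upperCentralSeries G (d + 1) = ⊤ :=
    Subgroup.upperCentralSeries_eq_top_iff_nilpotencyClass_le.2 (by omega)
  have hnoeth : ∀ K : Subgroup G, K.FG :=
    Subgroup.forall_fg_of_lowerCentralSeries_eq_bot (d + 1) G
      (Subgroup.lowerCentralSeries_eq_bot_iff_upperCentralSeries_eq_top.2 hup)
  have hfb : Function.Bijective f := ⟨injective_of_surjective_of_forall_fg hnoeth f hf, hf⟩
  have hindex : H.index ≠ 0 := hHm ▸ hm
  have hcen : centerOf H = H ⊓ Subgroup.center G := centerOf_eq_inf_center hG.torsionFree hindex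
  rw [hcen, Subgroup.inf_relIndex_right] at hq
  set Z := Subgroup.center G
  set γ := (⊤ : Subgroup G).lowerCentralSeries d with hγ
  set L := H.lowerCentralSeries d
  have hLγ : L ≤ γ := Subgroup.lowerCentralSeries_mono d le_top
  have hLH : L ≤ H := Subgroup.lowerCentralSeries_le_self H d
  have hγZ : γ ≤ Z := by
    have h := lowerCentralSeries_le_upperCentralSeries hup d 0 (add_zero d)
    rwa [zero_add, Subgroup.upperCentralSeries_one] at h
  have hk0 : k ≠ 0 := by
    rw [hk]
    exact fun h => hindex (zero_dvd_iff.1 (h ▸ Subgroup.index_dvd_of_le le_sup_left))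
  have hpow : ∀ x ∈ γ, x ^ k ^ (d + 1) ∈ L := by
    have h := pow_mem_lowerCentralSeries_sup hup H hk d 0 (add_zero d)
    rwa [Subgroup.upperCentralSeries_zero, sup_bot_eq] at h
  have hkd : k ^ (d + 1) ≠ 0 := pow_ne_zero _ hk0
  have hl0 : l ≠ 0 := hl ▸ Subgroup.relIndex_ne_zero_of_forall_pow_mem hγZ (hnoeth γ)
    fun x hx => ⟨_, hkd, hpow x hx⟩
  have hnum : IsNumberOver k l := ⟨hl0, fun p hp hpl =>
    hp.dvd_of_dvd_pow (Subgroup.prime_dvd_of_dvd_relIndex hγZ (hl ▸ hl0) hpow hp (hl ▸ hpl))⟩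
  have hcomap : γ.comap f = L.subgroupOf H := comap_lowerCentralSeries_eq hfb d
  have hlq : l ∣ q := by
    set T := centralIsolator γ
    have hTZ : T ≤ Z := fun x hx => hx.1
    have hγT : γ ≤ T := fun x hx => ⟨hγZ hx, 1, one_ne_zero, by rwa [pow_one]⟩
    have ht0 : γ.relIndex T ≠ 0 :=
      Subgroup.relIndex_ne_zero_of_forall_pow_mem hTZ (hnoeth T) fun x hx => hx.2
    have hTcomap : T.comap f = T.subgroupOf H :=
      comap_centralIsolator_eq hfb hcen hcomap hLγ ⟨_, hkd, hpow⟩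
    -- Transport along `f`, which sends `H ⊓ T` onto `T` and `L` onto `γ`.
    have ht : L.relIndex (H ⊓ T) = γ.relIndex T := by
      rw [← Subgroup.relIndex_subgroupOf (inf_le_left : H ⊓ T ≤ H), Subgroup.inf_subgroupOf_left,
        ← hcomap, ← hTcomap, Subgroup.relIndex_comap,
        Subgroup.map_comap_eq_self_of_surjective hf]
    have h1 : L.relIndex γ * γ.relIndex T = L.relIndex T :=
      Subgroup.relIndex_mul_relIndex L γ T hLγ hγT
    have h2 : L.relIndex (H ⊓ T) * (H ⊓ T).relIndex T = L.relIndex T :=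
      Subgroup.relIndex_mul_relIndex L (H ⊓ T) T (le_inf hLH (hLγ.trans hγT)) inf_le_right
    rw [ht, ← h1, mul_comm, Subgroup.inf_relIndex_right] at h2
    rw [hl, hq, ← Nat.eq_of_mul_eq_mul_right (Nat.pos_of_ne_zero ht0) h2]
    exact Subgroup.relIndex_dvd_relIndex_of_le_center H hTZ le_rfl
  have hq0 : q ≠ 0 := by
    rw [hq]
    exact fun h => hindex (Subgroup.index_eq_zero_of_relIndex_eq_zero h)
  refine ⟨⟨hcen ▸ inf_le_right, hq0⟩, ⟨hLγ, hnum, hlq⟩, fun hsimple hsq x y => ?_⟩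
  rcases Nat.eq_zero_or_pos d with h0 | hdpos
  · rw [h0, zero_add, Subgroup.upperCentralSeries_one] at hup
    exact Subgroup.mem_center_iff.1 (hup ▸ Subgroup.mem_top y) x
  exfalso
  have hl1 : l ≠ 1 := by
    intro h
    rw [hl, Subgroup.relIndex_eq_one] at h
    -- If `l = 1` then `γ = L` lies in `H` and is `f`-invariant, yet it is nontrivial in class `d +
    -- 1`.
    have hγcore : γ ≤ fCore f := (fCore_isGreatest f).2 ⟨inferInstance, h.trans hLH, fun x hx => by
      rw [← Subgroup.mem_comap, hcomap]
      exact h hx⟩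
    rw [show fCore f = ⊥ from hsimple, le_bot_iff, hγ,
      Subgroup.lowerCentralSeries_eq_bot_iff_nilpotencyClass_le] at hγcore
    omega
  obtain ⟨p, hp, hpl⟩ := Nat.exists_prime_and_dvd hl1
  have hZd : Z ≤ Subgroup.upperCentralSeries G d := by
    have h : Subgroup.upperCentralSeries G 1 ≤ Subgroup.upperCentralSeries G d :=
      Subgroup.upperCentralSeries_mono G hdpos
    rwa [Subgroup.upperCentralSeries_one] at h
  have hqkm : q * k ∣ m := by
    rw [hq, hk, ← hHm, ← Subgroup.relIndex_sup_of_le_center H le_rfl,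
      ← Subgroup.relIndex_mul_index (le_sup_left : H ≤ H ⊔ Z)]
    exact mul_dvd_mul_left _ (Subgroup.index_dvd_of_le (sup_le_sup_left hZd H))
  exact hp.not_isUnit (hsq p ((mul_dvd_mul (hpl.trans hlq) (hnum.2 p hp hpl)).trans hqkm))
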